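/- Consider a chain of $m+1$ nodes $0,1,\dots,m$. Node $0$ is given a uniformly random bit $\Theta\in\{0,1\}$. At each time step $i\in\{1,\dots,n\}$, each node $j\in\{0,\dots,m-1\}$ sends one bit $X_{i,j}$ to node $j+1$ through a binary symmetric channel with crossover probability $p\in(0,\tfrac12)$, whose output is $Y_{i,j}$; the channels are memoryless and independent across nodes. For $j\ge 1$ the bit $X_{i,j}$ may depend only on the previously received bits $Y_{1,j-1},\dots,Y_{i-1,j-1}$, and $X_{i,0}$ is a function of $\Theta$ (and $i$). After $n$ time steps node $m$ outputs an estimate $\hat\Theta$ computed from $Y_{1,m-1},\dots,Y_{n,m-1}$. Let $n^*(m,p)$ be the minimum $n$ for which there exists a protocol (encoding, relaying and decoding functions) with $\mathbb{P}(\hat\Theta\neq\Theta)\le\frac13$. The information velocity $v(p)=\lim_{m\to\infty}\frac{m}{n^*(m,p)}$ satisfies $v(p)=1-\Theta(p)$ as $p\to 0$, regardless of whether the limit, the $\liminf$ or the $\limsup$ is used in its definition. That is, there are constants $a,b>0$ and $p_0\in(0,\tfrac12]$ such that for all $p\in(0,p_0)$, $$1-b\,p\;\le\;\liminf_{m\to\infty}\frac{m}{n^*(m,p)}\;\le\;\limsup_{m\to\infty}\frac{m}{n^*(m,p)}\;\le\;1-a\,p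 .$$ -/

import Mathlib

open scoped ENNReal

/-- A (deterministic) protocol for relaying one bit over a chain of `m` links joining the nodes
`0, 1, …, m` in `n` time steps. Time steps are numbered `0, …, n - 1`; link `j` goes from
node `j` to node `j + 1`.

* `encode i θ` is the bit sent by node `0` (the encoder) at time `i` when the message is `θ`;
* `relay j i y` is the bit sent by the relay node `j` (`1 ≤ j < m`) at time `i` when the bits it
  received strictly before time `i` are `y 0, …, y (i - 1)` (the entry `j = 0` is not used);
* `decode y` is the estimate made by node `m` from all the `n` bits that it received. -/
structure RelayProtocol (m n : ℕ) where
  encode : Fin n → Bool → Bool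
  relay : Fin m → (i : Fin n) → (Fin i → Bool) → Bool
  decode : (Fin n → Bool) → Bool

namespace RelayProtocol

variable {m n : ℕ}

/-- `P.received θ z j _ i` is the bit received by node `j` at time `i` when the message is `θ` and
`z i j = true` means that link `j` flips the bit that it carries at time `i`.
(Node `0` is given `θ` itself.) -/
def received (P : RelayProtocol m n) (θ : Bool) (z : Fin n → Fin m → Bool) :
    (j : ℕ) → j ≤ m → Fin n → Bool
  | 0, _, _ => θ
  | 1, h, i => xor (P.encode i θ) (z i ⟨0, h⟩)
  | j + 2, h, i =>
      xor (P.relay ⟨j + 1, h⟩ i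
          (fun k : Fin i => P.received θ z (j + 1) (Nat.le_of_succ_le h) ⟨k, k.2.trans i.2⟩))
        (z i ⟨j + 1, h⟩)

/-- The estimate of the message `θ` that node `m` outputs under the noise pattern `z`. -/
def estimate (P : RelayProtocol m n) (θ : Bool) (z : Fin n → Fin m → Bool) : Bool :=
  P.decode (P.received θ z m le_rfl)

/-- The error probability: the message is uniform on `Bool`, and all the links are independent
memoryless binary symmetric channels with crossover probability `p`, i.e. the `n * m` noise bits
are independent `Bernoulli(p)` and independent of the message. -/
noncomputable def errorProb (P : RelayProtocol m n) (p : ℝ) : ℝ :=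
  ∑ θ : Bool, ∑ z : Fin n → Fin m → Bool,
    (1 / 2 : ℝ) * (∏ i, ∏ j, if z i j then p else 1 - p) *
      (if P.estimate θ z ≠ θ then 1 else 0)

end RelayProtocol

/-- The minimum block length `n` for which some protocol over `m` links has error probability at
most `1/3` (and `⊤` if there were no such `n`). -/
noncomputable def minBlockLength (m : ℕ) (p : ℝ) : ℕ∞ :=
  ⨅ (n : ℕ) (_ : ∃ P : RelayProtocol m n, P.errorProb p ≤ 1 / 3), (n : ℕ∞)

/-- The lower information velocity: the `liminf` of `m / n*(m, p)` as `m → ∞`. -/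
noncomputable def lowerVelocity (p : ℝ) : ℝ≥0∞ :=
  Filter.liminf (fun m : ℕ => (m : ℝ≥0∞) / (minBlockLength m p : ℝ≥0∞)) Filter.atTop

/-- The upper information velocity: the `limsup` of `m / n*(m, p)` as `m → ∞`. -/
noncomputable def upperVelocity (p : ℝ) : ℝ≥0∞ :=
  Filter.limsup (fun m : ℕ => (m : ℝ≥0∞) / (minBlockLength m p : ℝ≥0∞)) Filter.atTop

/-- The majority of three bits. -/
def majority (a b c : Bool) : Bool := (a && b) || (b && c) || (a && c)

theorem majority_eq {a b c x : Bool} (h₁ : a = x ∨ b = x) (h₂ : b = x ∨ c = x)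
    (h₃ : a = x ∨ c = x) : majority a b c = x := by
  revert h₁ h₂ h₃
  cases a <;> cases b <;> cases c <;> cases x <;> decide

/-- The `k`-fold iterated majority of three, applied to the `c`-th block of `3 ^ k` bits of `y`. -/
def blockMajority : ℕ → (ℕ → Bool) → ℕ → Bool
  | 0, y, c => y c
  | k + 1, y, c => majority (blockMajority k y (3 * c)) (blockMajority k y (3 * c + 1))
      (blockMajority k y (3 * c + 2))

theorem blockMajority_congr {k c : ℕ} {y y' : ℕ → Bool} (h : ∀ u, u / 3 ^ k = c → y u = y' u) :
    blockMajority k y c = blockMajority k y' c := by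
  induction k generalizing c with
  | zero => exact h c (by simp)
  | succ k ih =>
    have key : ∀ d, d / 3 = c → blockMajority k y d = blockMajority k y' d := fun d hd =>
      ih fun u hu => h u (by rw [pow_succ, ← Nat.div_div_eq_div_mul, hu, hd])
    simp only [blockMajority]
    rw [key (3 * c) (by omega), key (3 * c + 1) (by omega), key (3 * c + 2) (by omega)]

/-- The stream received at the end of a chain of `ℓ.length + 1` noisy links, the first of which has
number `J`, when the stream `x` enters the chain and the successive relays replace each block of
`3 ^ q` received bits, `q` being the entry of `ℓ`, by `3 ^ q` copies of its iterated majority.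
Every stream is indexed by the time elapsed since its sender started. -/
def relayChain (ζ : ℕ × ℕ → Bool) : ℕ → List ℕ → (ℕ → Bool) → ℕ → Bool
  | J, [], x => fun u => xor (x u) (ζ (J, u))
  | J, q :: ℓ, x => relayChain ζ (J + 1) ℓ
      (fun u => blockMajority q (fun v => xor (x v) (ζ (J, v))) (u / 3 ^ q))

theorem relayChain_append (ζ : ℕ × ℕ → Bool) (J : ℕ) (ℓ₁ : List ℕ) (q : ℕ) (ℓ₂ : List ℕ)
    (x : ℕ → Bool) :
    relayChain ζ J (ℓ₁ ++ q :: ℓ₂) x = relayChain ζ (J + ℓ₁.length + 1) ℓ₂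
      (fun u => blockMajority q (relayChain ζ J ℓ₁ x) (u / 3 ^ q)) := by
  induction ℓ₁ generalizing J x with
  | nil => simp [relayChain]
  | cons a ℓ₁ ih =>
    simp only [List.cons_append, relayChain, ih, List.length_cons]
    congr 1
    omega

/-- A chain is `k`-reliable with `N` witnesses if a block of `3 ^ k` equal bits that is decoded
wrongly at its end always exhibits one of `N` given sets of `2 ^ k` flipped bits of that block. -/
def Reliable (k : ℕ) (ℓ : List ℕ) (N : ℕ) : Prop :=
  ∀ J c : ℕ, ∃ F : Finset (Finset (ℕ × ℕ)), F.card ≤ N ∧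
    (∀ S ∈ F, S.card = 2 ^ k ∧ ∀ a ∈ S, a.2 / 3 ^ k = c) ∧
    ∀ (ζ : ℕ × ℕ → Bool) (x : ℕ → Bool) (b : Bool), (∀ u, u / 3 ^ k = c → x u = b) →
      (∀ S ∈ F, ∃ a ∈ S, ζ a = false) → blockMajority k (relayChain ζ J ℓ x) c = b

theorem reliable_nil : Reliable 0 [] 1 := by
  intro J c
  refine ⟨{{(J, c)}}, by simp, by simp, fun ζ x b hx hS => ?_⟩
  simp only [Finset.mem_singleton, forall_eq, exists_eq_left] at hS
  simp [blockMajority, relayChain, hS, hx c]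

theorem Reliable.append {k N₁ N₂ : ℕ} {ℓ₁ ℓ₂ : List ℕ} (h₁ : Reliable k ℓ₁ N₁)
    (h₂ : Reliable k ℓ₂ N₂) : Reliable k (ℓ₁ ++ k :: ℓ₂) (N₁ + N₂) := by
  intro J c
  obtain ⟨F₁, hc₁, hF₁, H₁⟩ := h₁ J c
  obtain ⟨F₂, hc₂, hF₂, H₂⟩ := h₂ (J + ℓ₁.length + 1) c
  refine ⟨F₁ ∪ F₂, (Finset.card_union_le _ _).trans (add_le_add hc₁ hc₂), ?_, ?_⟩
  · intro S hS
    rcases Finset.mem_union.1 hS with h | h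
    exacts [hF₁ S h, hF₂ S h]
  · intro ζ x b hx hS
    rw [relayChain_append]
    refine H₂ ζ _ b (fun u hu => ?_) fun S h => hS S (Finset.mem_union_right _ h)
    rw [hu]
    exact H₁ ζ x b hx fun S h => hS S (Finset.mem_union_left _ h)

theorem Reliable.succ {k N : ℕ} {ℓ : List ℕ} (h : Reliable k ℓ N) :
    Reliable (k + 1) ℓ (3 * N ^ 2) := by
  classical
  intro J c
  choose F hcard hF H using h J
  let G : ℕ → ℕ → Finset (Finset (ℕ × ℕ)) := fun d e => Finset.image₂ (· ∪ ·) (F d) (F e)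
  have hG : ∀ d e, (G d e).card ≤ N ^ 2 := fun d e =>
    (Finset.card_image₂_le _ _ _).trans (by rw [sq]; exact Nat.mul_le_mul (hcard d) (hcard e))
  have hdiv : ∀ u, u / 3 ^ (k + 1) = u / 3 ^ k / 3 := fun u => by
    rw [pow_succ, Nat.div_div_eq_div_mul]
  have hGS : ∀ d e, d ≠ e → d / 3 = c → e / 3 = c →
      ∀ S ∈ G d e, S.card = 2 ^ (k + 1) ∧ ∀ a ∈ S, a.2 / 3 ^ (k + 1) = c := by
    intro d e hde hd he S hS
    obtain ⟨A, hA, B, hB, rfl⟩ := Finset.mem_image₂.1 hS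
    constructor
    · rw [Finset.card_union_of_disjoint, (hF d A hA).1, (hF e B hB).1, pow_succ, mul_two]
      exact Finset.disjoint_left.2 fun a ha hb =>
        hde (((hF d A hA).2 a ha).symm.trans ((hF e B hB).2 a hb))
    · intro a ha
      rw [hdiv]
      rcases Finset.mem_union.1 ha with ha | ha
      · rw [(hF d A hA).2 a ha, hd]
      · rw [(hF e B hB).2 a ha, he]
  refine ⟨G (3 * c) (3 * c + 1) ∪ G (3 * c + 1) (3 * c + 2) ∪ G (3 * c) (3 * c + 2), ?_, ?_, ?_⟩
  · have h1 := Finset.card_union_le (G (3 * c) (3 * c + 1) ∪ G (3 * c + 1) (3 * c + 2))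
      (G (3 * c) (3 * c + 2))
    have h2 := Finset.card_union_le (G (3 * c) (3 * c + 1)) (G (3 * c + 1) (3 * c + 2))
    have h3 := hG (3 * c) (3 * c + 1)
    have h4 := hG (3 * c + 1) (3 * c + 2)
    have h5 := hG (3 * c) (3 * c + 2)
    omega
  · intro S hS
    simp only [Finset.mem_union] at hS
    rcases hS with (hS | hS) | hS
    · exact hGS _ _ (by omega) (by omega) (by omega) S hS
    · exact hGS _ _ (by omega) (by omega) (by omega) S hS
    · exact hGS _ _ (by omega) (by omega) (by omega) S hS
  · intro ζ x b hx hS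
    have hpair : ∀ d e, d / 3 = c → e / 3 = c → (∀ S ∈ G d e, ∃ a ∈ S, ζ a = false) →
        blockMajority k (relayChain ζ J ℓ x) d = b ∨
          blockMajority k (relayChain ζ J ℓ x) e = b := by
      intro d e hd he hde
      by_cases hA : ∀ S ∈ F d, ∃ a ∈ S, ζ a = false
      · exact Or.inl (H d ζ x b (fun u hu => hx u (by rw [hdiv, hu, hd])) hA)
      · refine Or.inr (H e ζ x b (fun u hu => hx u (by rw [hdiv, hu, he])) fun B hB => ?_)
        push Not at hA
        obtain ⟨A, hA, hζ⟩ := hA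
        obtain ⟨a, ha, hza⟩ := hde _ (Finset.mem_image₂_of_mem hA hB)
        rcases Finset.mem_union.1 ha with ha | ha
        · exact absurd hza (hζ a ha)
        · exact ⟨a, ha, hza⟩
    simp only [Finset.mem_union] at hS
    have h1 := hpair (3 * c) (3 * c + 1) (by omega) (by omega) fun S h => hS S (.inl (.inl h))
    have h2 := hpair (3 * c + 1) (3 * c + 2) (by omega) (by omega) fun S h => hS S (.inl (.inr h))
    have h3 := hpair (3 * c) (3 * c + 2) (by omega) (by omega) fun S h => hS S (.inr h)
    exact majority_eq h1 h2 h3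

/-- The total delay of the relays of the chain `ℓ`: a relay of level `q` waits for `3 ^ q` bits. -/
def chainDelay (ℓ : List ℕ) : ℕ := (ℓ.map (3 ^ ·)).sum

theorem exists_reliable_mul {k N M δ : ℕ}
    (h : ∀ m, 1 ≤ m → m ≤ M → ∃ ℓ : List ℕ, ℓ.length + 1 = m ∧ Reliable k ℓ N ∧
      chainDelay ℓ + 3 ^ k ≤ m + δ) (r : ℕ) :
    ∀ m, 1 ≤ m → m ≤ (r + 1) * M → ∃ ℓ : List ℕ, ℓ.length + 1 = m ∧ Reliable k ℓ ((r + 1) * N) ∧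
      chainDelay ℓ + 3 ^ k ≤ m + (r + 1) * δ := by
  induction r with
  | zero => simpa using h
  | succ r ih =>
    intro m hm hmM
    by_cases hle : m ≤ (r + 1) * M
    · obtain ⟨ℓ, hℓ, hR, hd⟩ := ih m hm hle
      refine ⟨ℓ, hℓ, fun J c => ?_, hd.trans (by gcongr; omega)⟩
      obtain ⟨F, hF, hF'⟩ := hR J c
      exact ⟨F, hF.trans (by gcongr; omega), hF'⟩
    · push Not at hle
      by_cases hM : M = 0
      · subst hM; omega
      obtain ⟨ℓ₁, hℓ₁, hR₁, hd₁⟩ := ih ((r + 1) * M) (Nat.mul_pos (by omega) (by omega)) le_rfl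
      obtain ⟨ℓ₂, hℓ₂, hR₂, hd₂⟩ := h (m - (r + 1) * M) (by omega)
        (by rw [Nat.succ_mul (r + 1)] at hmM; omega)
      refine ⟨ℓ₁ ++ k :: ℓ₂, ?_, ?_, ?_⟩
      · simp only [List.length_append, List.length_cons]; omega
      · have := hR₁.append hR₂
        rwa [← Nat.succ_mul] at this
      · have : chainDelay (ℓ₁ ++ k :: ℓ₂) = chainDelay ℓ₁ + 3 ^ k + chainDelay ℓ₂ := by
          simp [chainDelay, add_assoc]
        rw [this, Nat.succ_mul (r + 1) δ]
        omega

theorem exists_reliable {p : ℝ} (hp : 0 ≤ p) {R : ℕ} (hR : 1 ≤ R) (hRp : R * p ≤ 1 / 18) (k : ℕ) :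
    ∃ N δ : ℕ, N * p ^ 2 ^ (k + 1) ≤ 1 / 108 ∧ δ + 2 * 3 ^ k = 4 * 6 ^ k ∧
      ∀ m, 1 ≤ m → m ≤ R * 6 ^ k → ∃ ℓ : List ℕ, ℓ.length + 1 = m ∧ Reliable (k + 1) ℓ N ∧
        chainDelay ℓ + 3 ^ (k + 1) ≤ m + δ := by
  induction k with
  | zero =>
    have h0 : ∀ m, 1 ≤ m → m ≤ 1 → ∃ ℓ : List ℕ, ℓ.length + 1 = m ∧ Reliable 0 ℓ 1 ∧
        chainDelay ℓ + 3 ^ 0 ≤ m + 0 := fun m h1 h2 =>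
      ⟨[], by simp; omega, reliable_nil, by simp [chainDelay]; omega⟩
    obtain ⟨r, rfl⟩ : ∃ r, R = r + 1 := ⟨R - 1, by omega⟩
    refine ⟨3 * ((r + 1) * 1) ^ 2, 2, ?_, by norm_num, fun m h1 h2 => ?_⟩
    · have : 0 ≤ ((r + 1 : ℕ) : ℝ) * p := by positivity
      push_cast at this hRp ⊢
      nlinarith
    · obtain ⟨ℓ, hℓ, hrel, hd⟩ := exists_reliable_mul h0 r m h1 (by simpa using h2)
      exact ⟨ℓ, hℓ, hrel.succ, by simp at hd ⊢; omega⟩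
  | succ k ih =>
    obtain ⟨N, δ, hN, hδ, h⟩ := ih
    refine ⟨3 * ((5 + 1) * N) ^ 2, (5 + 1) * δ + 2 * 3 ^ (k + 1), ?_, ?_, fun m h1 h2 => ?_⟩
    · have h0 : 0 ≤ (N : ℝ) * p ^ 2 ^ (k + 1) := by positivity
      have : ((3 * ((5 + 1) * N) ^ 2 : ℕ) : ℝ) * p ^ 2 ^ (k + 1 + 1) =
          108 * (N * p ^ 2 ^ (k + 1)) ^ 2 := by
        rw [pow_succ 2 (k + 1), pow_mul]
        push_cast
        ring
      rw [this]
      nlinarith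
    · rw [pow_succ 3, pow_succ 6]
      omega
    · obtain ⟨ℓ, hℓ, hrel, hd⟩ := exists_reliable_mul h 5 m h1 (h2.trans (by rw [pow_succ]; linarith))
      exact ⟨ℓ, hℓ, hrel.succ, by rw [pow_succ 3 (k + 1)]; omega⟩

/-- The protocol in which the relays act as in `relayChain` and the last node outputs the iterated
majority of the `3 ^ k` bits that it receives last. -/
def majorityProtocol (ℓ : List ℕ) (k : ℕ) :
    RelayProtocol (ℓ.length + 1) (chainDelay ℓ + 3 ^ k) where
  encode _ θ := θ
  relay j i y := blockMajority (ℓ.getD (j - 1) 0)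
    (fun u => if h : chainDelay (ℓ.take (j - 1)) + u < i then y ⟨_, h⟩ else false)
    ((i - chainDelay (ℓ.take j)) / 3 ^ ℓ.getD (j - 1) 0)
  decode y := blockMajority k
    (fun u => if h : chainDelay ℓ + u < chainDelay ℓ + 3 ^ k then y ⟨_, h⟩ else false) 0

/-- The noise bits of the links, indexed by the link and the time elapsed since its sender started
(and `false` outside of the range of the protocol). -/
def shiftedNoise (ℓ : List ℕ) (k : ℕ)
    (z : Fin (chainDelay ℓ + 3 ^ k) → Fin (ℓ.length + 1) → Bool) (a : ℕ × ℕ) : Bool :=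
  if h : a.1 < ℓ.length + 1 ∧ chainDelay (ℓ.take a.1) + a.2 < chainDelay ℓ + 3 ^ k then
    z ⟨_, h.2⟩ ⟨_, h.1⟩ else false

theorem received_majorityProtocol (ℓ : List ℕ) (k : ℕ) (θ : Bool)
    (z : Fin (chainDelay ℓ + 3 ^ k) → Fin (ℓ.length + 1) → Bool) (j : ℕ)
    (hj : j + 1 ≤ ℓ.length + 1) (u : ℕ)
    (hu : chainDelay (ℓ.take j) + u < chainDelay ℓ + 3 ^ k) :
    (majorityProtocol ℓ k).received θ z (j + 1) hj ⟨chainDelay (ℓ.take j) + u, hu⟩ =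
      relayChain (shiftedNoise ℓ k z) 0 (ℓ.take j) (fun _ => θ) u := by
  induction j generalizing u with
  | zero =>
    have : chainDelay [] + u < chainDelay ℓ + 3 ^ k := by simpa using hu
    simp [RelayProtocol.received, relayChain, shiftedNoise, majorityProtocol, this]
  | succ j ih =>
    have hjℓ : j < ℓ.length := by omega
    have htake : ℓ.take (j + 1) = ℓ.take j ++ [ℓ[j]] := (List.take_append_getElem hjℓ).symm
    have hdelay : chainDelay (ℓ.take (j + 1)) = chainDelay (ℓ.take j) + 3 ^ ℓ[j] := by
      rw [htake]
      simp only [chainDelay, List.map_append, List.sum_append, List.map_cons, List.map_nil,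
        List.sum_cons, List.sum_nil, add_zero]
    have hgetD : ℓ.getD j 0 = ℓ[j] := by simp [hjℓ]
    rw [RelayProtocol.received]
    conv_rhs => rw [htake, relayChain_append]
    simp only [relayChain]
    congr 1
    · simp only [majorityProtocol, Nat.add_sub_cancel, hgetD, Nat.add_sub_cancel_left]
      refine blockMajority_congr fun v hv => ?_
      have hv' : v < u + 3 ^ ℓ[j] := by
        have h3 : 0 < 3 ^ ℓ[j] := by positivity
        have h1 := Nat.div_add_mod v (3 ^ ℓ[j])
        have h2 := Nat.mod_lt v h3
        have h4 := Nat.mul_div_le u (3 ^ ℓ[j])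
        rw [hv] at h1
        omega
      rw [dif_pos (by omega)]
      exact ih (by omega) v (by omega)
    · simp only [shiftedNoise, List.length_take, zero_add]
      rw [dif_pos ⟨by omega, by rw [min_eq_left hjℓ.le]; exact hu⟩]
      congr 1
      · simp [min_eq_left hjℓ.le]
      · simp [min_eq_left hjℓ.le]

theorem estimate_majorityProtocol (ℓ : List ℕ) (k : ℕ) (θ : Bool)
    (z : Fin (chainDelay ℓ + 3 ^ k) → Fin (ℓ.length + 1) → Bool) :
    (majorityProtocol ℓ k).estimate θ z =
      blockMajority k (relayChain (shiftedNoise ℓ k z) 0 ℓ (fun _ => θ)) 0 := by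
  simp only [RelayProtocol.estimate]
  conv_lhs => simp only [majorityProtocol]
  refine blockMajority_congr fun u hu => ?_
  have hu' : u < 3 ^ k := by
    rcases Nat.div_eq_zero_iff.1 hu with h | h
    · exact absurd h (by positivity)
    · exact h
  rw [dif_pos (by omega)]
  have := received_majorityProtocol ℓ k θ z ℓ.length le_rfl u (by simpa using hu')
  simp only [List.take_length] at this
  exact this

theorem sum_noise_weight_forall (p : ℝ) {m n : ℕ} (T : Finset (Fin n × Fin m)) :
    ∑ z : Fin n → Fin m → Bool, (∏ i, ∏ j, if z i j then p else 1 - p) *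
      (if ∀ a ∈ T, z a.1 a.2 = true then 1 else 0) = p ^ T.card := by
  classical
  have h1 : ∀ z : Fin n × Fin m → Bool, (∏ i, ∏ j, if z (i, j) then p else 1 - p) *
      (if ∀ a ∈ T, z (a.1, a.2) = true then (1 : ℝ) else 0) =
      ∏ a, (if z a then p else 1 - p) * (if a ∈ T → z a = true then 1 else 0) := by
    intro z
    rw [Finset.prod_mul_distrib, Fintype.prod_prod_type, Finset.prod_boole]
    simp
  rw [← Equiv.sum_comp (Equiv.curry (Fin n) (Fin m) Bool)]
  simp only [Equiv.curry_apply, Function.curry_apply]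
  rw [Finset.sum_congr rfl fun z _ => h1 z]
  rw [← Fintype.prod_sum fun (a : Fin n × Fin m) (b : Bool) =>
    (if b then p else 1 - p) * (if a ∈ T → b = true then (1 : ℝ) else 0)]
  have h2 : ∀ a, (∑ b : Bool, (if b then p else 1 - p) *
      (if a ∈ T → b = true then (1 : ℝ) else 0)) = if a ∈ T then p else 1 := by
    intro a
    by_cases h : a ∈ T <;> simp [h]
  simp only [h2]
  simp [Finset.prod_ite_mem]

theorem sum_shiftedNoise_weight_le {p : ℝ} (hp : 0 ≤ p) (ℓ : List ℕ) (k : ℕ)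
    (S : Finset (ℕ × ℕ)) :
    ∑ z : Fin (chainDelay ℓ + 3 ^ k) → Fin (ℓ.length + 1) → Bool,
      (∏ i, ∏ j, if z i j then p else 1 - p) *
        (if ∀ a ∈ S, shiftedNoise ℓ k z a = true then 1 else 0) ≤ p ^ S.card := by
  classical
  by_cases hS : ∀ a ∈ S, a.1 < ℓ.length + 1 ∧
      chainDelay (ℓ.take a.1) + a.2 < chainDelay ℓ + 3 ^ k
  · let f : S → Fin (chainDelay ℓ + 3 ^ k) × Fin (ℓ.length + 1) := fun a =>
      (⟨_, (hS a a.2).2⟩, ⟨_, (hS a a.2).1⟩)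
    have hf : Function.Injective f := by
      intro a b hab
      simp only [f, Prod.mk.injEq, Fin.mk.injEq] at hab
      obtain ⟨h1, h2⟩ := hab
      rw [h2] at h1
      exact Subtype.ext (Prod.ext h2 (by omega))
    refine le_of_eq ?_
    have hcard : (S.attach.image f).card = S.card := by
      rw [Finset.card_image_of_injective _ hf, Finset.card_attach]
    rw [← hcard, ← sum_noise_weight_forall]
    refine Finset.sum_congr rfl fun z _ => ?_
    congr 1
    refine if_congr ?_ rfl rfl
    constructor
    · intro h a ha
      obtain ⟨b, -, rfl⟩ := Finset.mem_image.1 ha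
      have := h b b.2
      rwa [shiftedNoise, dif_pos (hS b b.2)] at this
    · intro h a ha
      rw [shiftedNoise, dif_pos (hS a ha)]
      exact h (f ⟨a, ha⟩) (Finset.mem_image_of_mem _ (Finset.mem_attach _ _))
  · push Not at hS
    obtain ⟨a, ha, hS⟩ := hS
    rw [Finset.sum_eq_zero]
    · positivity
    · intro z _
      rw [if_neg, mul_zero]
      intro h
      have := h a ha
      rw [shiftedNoise, dif_neg fun h => absurd h.2 (not_lt.2 (hS h.1))] at this
      exact absurd this (by simp)

theorem errorProb_majorityProtocol_le {p : ℝ} (hp : 0 ≤ p) (hp1 : p ≤ 1) {ℓ : List ℕ} {k N : ℕ}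
    (h : Reliable k ℓ N) : (majorityProtocol ℓ k).errorProb p ≤ N * p ^ 2 ^ k := by
  classical
  obtain ⟨F, hcard, hF, H⟩ := h 0 0
  have hθ : ∀ θ : Bool, ∑ z : Fin (chainDelay ℓ + 3 ^ k) → Fin (ℓ.length + 1) → Bool,
      (1 / 2 : ℝ) * (∏ i, ∏ j, if z i j then p else 1 - p) *
        (if (majorityProtocol ℓ k).estimate θ z ≠ θ then 1 else 0) ≤
      1 / 2 * (N * p ^ 2 ^ k) := by
    intro θ
    calc _ ≤ ∑ z : Fin (chainDelay ℓ + 3 ^ k) → Fin (ℓ.length + 1) → Bool, ∑ S ∈ F,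
          1 / 2 * ((∏ i, ∏ j, if z i j then p else 1 - p) *
            (if ∀ a ∈ S, shiftedNoise ℓ k z a = true then 1 else 0)) := by
          refine Finset.sum_le_sum fun z _ => ?_
          have hw : 0 ≤ ∏ i, ∏ j, if z i j then p else 1 - p :=
            Finset.prod_nonneg fun i _ => Finset.prod_nonneg fun j _ => by
              split_ifs <;> linarith
          have hnn : ∀ S ∈ F, 0 ≤ 1 / 2 * ((∏ i, ∏ j, if z i j then p else 1 - p) *
              (if ∀ a ∈ S, shiftedNoise ℓ k z a = true then (1 : ℝ) else 0)) := fun S _ => by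
            positivity
          split_ifs with hne
          · have : ¬ ∀ S ∈ F, ∃ a ∈ S, shiftedNoise ℓ k z a = false := fun hS =>
              hne (by rw [estimate_majorityProtocol]; exact H _ _ θ (fun _ _ => rfl) hS)
            push Not at this
            obtain ⟨S, hS, hSz⟩ := this
            refine le_trans (le_of_eq ?_) (Finset.single_le_sum hnn hS)
            rw [if_pos fun a ha => by simpa using hSz a ha]
            ring
          · rw [mul_zero]
            exact Finset.sum_nonneg hnn
      _ = ∑ S ∈ F, 1 / 2 * ∑ z : Fin (chainDelay ℓ + 3 ^ k) → Fin (ℓ.length + 1) → Bool,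
          (∏ i, ∏ j, if z i j then p else 1 - p) *
            (if ∀ a ∈ S, shiftedNoise ℓ k z a = true then 1 else 0) := by
          rw [Finset.sum_comm]
          simp only [Finset.mul_sum]
      _ ≤ ∑ S ∈ F, 1 / 2 * p ^ 2 ^ k := by
          refine Finset.sum_le_sum fun S hS => ?_
          gcongr
          rw [← (hF S hS).1]
          exact sum_shiftedNoise_weight_le hp ℓ k S
      _ = 1 / 2 * (F.card * p ^ 2 ^ k) := by rw [Finset.sum_const, nsmul_eq_mul]; ring
      _ ≤ _ := by gcongr
  calc (majorityProtocol ℓ k).errorProb p ≤ ∑ _θ : Bool, 1 / 2 * (N * p ^ 2 ^ k) :=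
        Finset.sum_le_sum fun θ _ => hθ θ
    _ = N * p ^ 2 ^ k := by rw [Fintype.sum_bool]; ring

/-- The probability that a bit with crossover probability `p` is flipped (`true`) or not. -/
def flipWeight (p : ℝ) (b : Bool) : ℝ := if b then p else 1 - p

theorem flipWeight_xor (p : ℝ) (a b : Bool) :
    flipWeight p (xor a b) = (1 - 2 * p) * (if a = b then 1 else 0) + p := by
  cases a <;> cases b <;> simp [flipWeight] <;> ring

theorem sum_flipWeight_xor (p : ℝ) (a : Bool) : ∑ b, flipWeight p (xor a b) = 1 := by
  cases a <;> simp [flipWeight]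

theorem sum_fin_succ_fun {α : Type*} [Fintype α] {i : ℕ} (f : (Fin (i + 1) → α) → ℝ) :
    ∑ y, f y = ∑ y : Fin i → α, ∑ b : α, f (Fin.snoc y b) := by
  rw [← Equiv.sum_comp (Fin.snocEquiv fun _ : Fin (i + 1) => α), Fintype.sum_prod_type,
    Finset.sum_comm]
  rfl

/-- The probability of receiving `y'` from a node that uses the strategy `r` and receives `y`. -/
def linkKernel (p : ℝ) (r : (k : ℕ) → (Fin k → Bool) → Bool) (i : ℕ) (y y' : Fin i → Bool) : ℝ :=
  ∏ k : Fin i, flipWeight p (xor (r k fun l => y ⟨l, l.2.trans k.2⟩) (y' k))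

section linkKernel

variable (p : ℝ) (r : (k : ℕ) → (Fin k → Bool) → Bool)

theorem linkKernel_snoc {i : ℕ} (y y' : Fin i → Bool) (a b : Bool) :
    linkKernel p r (i + 1) (Fin.snoc y a) (Fin.snoc y' b) =
      linkKernel p r i y y' * flipWeight p (xor (r i y) b) := by
  have h : ∀ (k : ℕ) (hk : k < i) (hk' : k < i + 1),
      (Fin.snoc y a : Fin (i + 1) → Bool) ⟨k, hk'⟩ = y ⟨k, hk⟩ := fun k hk _ =>
    Fin.snoc_castSucc (α := fun _ : Fin (i + 1) => Bool) a y ⟨k, hk⟩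
  rw [linkKernel, Fin.prod_univ_castSucc]
  congr 1
  · refine Finset.prod_congr rfl fun k _ => ?_
    rw [Fin.snoc_castSucc]
    congr 2
    simp only [Fin.val_castSucc]
    congr 1
    funext l
    exact h l (l.2.trans k.2) _
  · rw [Fin.snoc_last]
    congr 2
    simp only [Fin.val_last]
    congr 1
    funext l
    exact h l l.2 _

theorem sum_linkKernel {i : ℕ} (y : Fin i → Bool) : ∑ y', linkKernel p r i y y' = 1 := by
  simp only [linkKernel]
  rw [← Fintype.prod_sum fun (k : Fin i) (b : Bool) =>
    flipWeight p (xor (r k fun l => y ⟨l, l.2.trans k.2⟩) b)]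
  exact Finset.prod_eq_one fun k _ => sum_flipWeight_xor p _

variable {p} in
theorem linkKernel_nonneg (hp : 0 ≤ p) (hp1 : p ≤ 1) {i : ℕ} (y y' : Fin i → Bool) :
    0 ≤ linkKernel p r i y y' :=
  Finset.prod_nonneg fun k _ => by unfold flipWeight; split_ifs <;> linarith

/-- The signed measures on received prefixes after a link, given those before it. -/
def linkPush (δ : (i : ℕ) → (Fin i → Bool) → ℝ) (i : ℕ) (y' : Fin i → Bool) : ℝ :=
  ∑ y, δ i y * linkKernel p r i y y'

end linkKernel

/-- A family of signed measures on prefixes in which each one is the marginal of the next one. -/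
def PrefixConsistent (δ : (i : ℕ) → (Fin i → Bool) → ℝ) : Prop :=
  ∀ i y, ∑ b, δ (i + 1) (Fin.snoc y b) = δ i y

/-- The total mass of the absolute values. -/
def prefixNorm (δ : (i : ℕ) → (Fin i → Bool) → ℝ) (i : ℕ) : ℝ := ∑ y, |δ i y|

theorem linkPush_snoc (p : ℝ) (r : (k : ℕ) → (Fin k → Bool) → Bool)
    {δ : (i : ℕ) → (Fin i → Bool) → ℝ} (hδ : PrefixConsistent δ) {i : ℕ} (y' : Fin i → Bool)
    (b : Bool) : linkPush p r δ (i + 1) (Fin.snoc y' b) =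
      ∑ y, δ i y * (linkKernel p r i y y' * flipWeight p (xor (r i y) b)) := by
  rw [linkPush, sum_fin_succ_fun]
  refine Finset.sum_congr rfl fun y _ => ?_
  simp only [linkKernel_snoc]
  rw [← Finset.sum_mul, hδ]

theorem PrefixConsistent.linkPush (p : ℝ) (r : (k : ℕ) → (Fin k → Bool) → Bool)
    {δ : (i : ℕ) → (Fin i → Bool) → ℝ} (hδ : PrefixConsistent δ) :
    PrefixConsistent (linkPush p r δ) := by
  intro i y'
  simp only [linkPush_snoc p r hδ]
  rw [Finset.sum_comm]
  refine Finset.sum_congr rfl fun y _ => ?_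
  rw [← Finset.mul_sum, ← Finset.mul_sum, sum_flipWeight_xor, mul_one]

theorem prefixNorm_linkPush_zero (p : ℝ) (r : (k : ℕ) → (Fin k → Bool) → Bool)
    (δ : (i : ℕ) → (Fin i → Bool) → ℝ) : prefixNorm (linkPush p r δ) 0 = prefixNorm δ 0 := by
  simp [prefixNorm, linkPush, linkKernel]

/-- The data processing inequality for a binary symmetric channel, seen as a degraded binary
erasure channel with erasure probability `2 * p`. -/
theorem prefixNorm_linkPush_succ_le {p : ℝ} (hp : 0 ≤ p) (hp2 : p ≤ 1 / 2)
    (r : (k : ℕ) → (Fin k → Bool) → Bool) {δ : (i : ℕ) → (Fin i → Bool) → ℝ}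
    (hδ : PrefixConsistent δ) (i : ℕ) :
    prefixNorm (linkPush p r δ) (i + 1) ≤
      (1 - 2 * p) * prefixNorm δ i + 2 * p * prefixNorm (linkPush p r δ) i := by
  have hK := fun y y' => linkKernel_nonneg r hp (by linarith : p ≤ 1) (i := i) y y'
  have h2p : 0 ≤ 1 - 2 * p := by linarith
  have hstep : ∀ (y' : Fin i → Bool) (b : Bool), |linkPush p r δ (i + 1) (Fin.snoc y' b)| ≤
      (1 - 2 * p) * ∑ y, |δ i y| * (linkKernel p r i y y' * (if r i y = b then 1 else 0)) +
        p * |linkPush p r δ i y'| := by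
    intro y' b
    have : linkPush p r δ (i + 1) (Fin.snoc y' b) =
        (1 - 2 * p) * ∑ y, δ i y * (linkKernel p r i y y' * (if r i y = b then 1 else 0)) +
          p * linkPush p r δ i y' := by
      rw [linkPush_snoc p r hδ, linkPush, Finset.mul_sum, Finset.mul_sum, ← Finset.sum_add_distrib]
      refine Finset.sum_congr rfl fun y _ => ?_
      rw [flipWeight_xor]
      ring
    rw [this]
    refine (abs_add_le _ _).trans ?_
    rw [abs_mul, abs_mul, abs_of_nonneg h2p, abs_of_nonneg hp]
    gcongr
    refine (Finset.abs_sum_le_sum_abs _ _).trans (Finset.sum_le_sum fun y _ => ?_)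
    rw [abs_mul, abs_of_nonneg (mul_nonneg (hK y y') (by split_ifs <;> norm_num))]
  have hsum : ∑ y' : Fin i → Bool, ∑ b : Bool, ∑ y,
      |δ i y| * (linkKernel p r i y y' * (if r i y = b then 1 else 0)) = prefixNorm δ i := by
    have h1 : ∀ y' : Fin i → Bool, ∑ b : Bool, ∑ y,
        |δ i y| * (linkKernel p r i y y' * (if r i y = b then 1 else 0)) =
        ∑ y, |δ i y| * linkKernel p r i y y' := by
      intro y'
      rw [Finset.sum_comm]
      refine Finset.sum_congr rfl fun y _ => ?_
      rw [← Finset.mul_sum, ← Finset.mul_sum]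
      simp
    simp only [h1]
    rw [Finset.sum_comm]
    refine Finset.sum_congr rfl fun y _ => ?_
    rw [← Finset.mul_sum, sum_linkKernel, mul_one]
  rw [prefixNorm, sum_fin_succ_fun]
  calc _ ≤ ∑ y' : Fin i → Bool, ∑ b : Bool, ((1 - 2 * p) *
        ∑ y, |δ i y| * (linkKernel p r i y y' * (if r i y = b then 1 else 0)) +
          p * |linkPush p r δ i y'|) :=
        Finset.sum_le_sum fun y' _ => Finset.sum_le_sum fun b _ => hstep y' b
    _ = (1 - 2 * p) * prefixNorm δ i + 2 * p * prefixNorm (linkPush p r δ) i := by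
        simp only [Finset.sum_add_distrib, ← Finset.mul_sum, hsum]
        simp [prefixNorm, ← Finset.mul_sum]
        ring

/-- The laws of the prefixes received by the successive nodes, for the strategies `r`. -/
def prefixLaw (p : ℝ) (r : ℕ → (k : ℕ) → (Fin k → Bool) → Bool) (θ : Bool) :
    ℕ → (i : ℕ) → (Fin i → Bool) → ℝ
  | 0 => fun _ y => if y = fun _ => θ then 1 else 0
  | j + 1 => linkPush p (r j) (prefixLaw p r θ j)

theorem prefixLaw_consistent (p : ℝ) (r : ℕ → (k : ℕ) → (Fin k → Bool) → Bool) (θ : Bool)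
    (j : ℕ) : PrefixConsistent (prefixLaw p r θ j) := by
  induction j with
  | zero =>
    intro i y
    have h : ∀ b, ((Fin.snoc y b : Fin (i + 1) → Bool) = fun _ => θ) ↔
        (y = fun _ => θ) ∧ b = θ := by
      intro b
      constructor
      · intro h
        exact ⟨funext fun k => by simpa using congrFun h k.castSucc,
          by simpa using congrFun h (Fin.last i)⟩
      · rintro ⟨rfl, rfl⟩
        funext k
        refine Fin.lastCases ?_ (fun k => ?_) k <;> simp
    simp only [prefixLaw, h]
    by_cases hy : y = fun _ => θ <;> simp [hy]
  | succ j ih => exact ih.linkPush p (r j)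

theorem prefixLaw_nonneg {p : ℝ} (hp : 0 ≤ p) (hp1 : p ≤ 1)
    (r : ℕ → (k : ℕ) → (Fin k → Bool) → Bool) (θ : Bool) (j i : ℕ) (y : Fin i → Bool) :
    0 ≤ prefixLaw p r θ j i y := by
  induction j generalizing y with
  | zero => simp only [prefixLaw]; split_ifs <;> norm_num
  | succ j ih =>
    exact Finset.sum_nonneg fun y' _ => mul_nonneg (ih y') (linkKernel_nonneg _ hp hp1 _ _)

theorem sum_prefixLaw (p : ℝ) (r : ℕ → (k : ℕ) → (Fin k → Bool) → Bool) (θ : Bool) (j i : ℕ) :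
    ∑ y, prefixLaw p r θ j i y = 1 := by
  induction j with
  | zero => simp [prefixLaw]
  | succ j ih =>
    simp only [prefixLaw, linkPush]
    rw [Finset.sum_comm]
    simp only [← Finset.mul_sum, sum_linkKernel, mul_one, ih]

theorem linkPush_sub (p : ℝ) (r : (k : ℕ) → (Fin k → Bool) → Bool)
    (δ δ' : (i : ℕ) → (Fin i → Bool) → ℝ) :
    linkPush p r (δ - δ') = linkPush p r δ - linkPush p r δ' := by
  funext i y
  simp [linkPush, sub_mul]

theorem prefixNorm_sub_prefixLaw_le {p : ℝ} (hp : 0 ≤ p) (hp2 : p ≤ 1 / 2)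
    (r r' : ℕ → (k : ℕ) → (Fin k → Bool) → Bool) (hr : ∀ j, r (j + 1) = r' (j + 1)) (θ θ' : Bool)
    (j i : ℕ) : prefixNorm (prefixLaw p r θ (j + 1) - prefixLaw p r' θ' (j + 1)) i ≤
      2 * (1 / (1 + p)) ^ j * (1 + (1 - 2 * p) * p) ^ i := by
  have hY : 1 ≤ 1 + (1 - 2 * p) * p := by nlinarith
  have hpos : (0 : ℝ) < 1 + p := by linarith
  induction j generalizing i with
  | zero =>
    have h1 : prefixNorm (prefixLaw p r θ 1 - prefixLaw p r' θ' 1) i ≤ 2 := by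
      calc _ ≤ ∑ y, (prefixLaw p r θ 1 i y + prefixLaw p r' θ' 1 i y) := by
            refine Finset.sum_le_sum fun y _ => ?_
            have h := prefixLaw_nonneg hp (by linarith) r θ 1 i y
            have h' := prefixLaw_nonneg hp (by linarith) r' θ' 1 i y
            simp only [Pi.sub_apply]
            rw [abs_le]
            constructor <;> linarith
        _ = 2 := by rw [Finset.sum_add_distrib, sum_prefixLaw, sum_prefixLaw]; norm_num
    have h2 : 1 ≤ (1 + (1 - 2 * p) * p) ^ i := one_le_pow₀ hY
    simp only [zero_add, pow_zero]
    linarith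
  | succ j ih =>
    have hpush : prefixLaw p r θ (j + 1 + 1) - prefixLaw p r' θ' (j + 1 + 1) =
        linkPush p (r (j + 1)) (prefixLaw p r θ (j + 1) - prefixLaw p r' θ' (j + 1)) := by
      rw [linkPush_sub, prefixLaw.eq_2 p r θ (j + 1), prefixLaw.eq_2 p r' θ' (j + 1), hr]
    have hcons : PrefixConsistent (prefixLaw p r θ (j + 1) - prefixLaw p r' θ' (j + 1)) := by
      intro i y
      have h := prefixLaw_consistent p r θ (j + 1) i y
      have h' := prefixLaw_consistent p r' θ' (j + 1) i y
      simp only [Pi.sub_apply, Finset.sum_sub_distrib, h, h']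
    rw [hpush]
    induction i with
    | zero =>
      rw [prefixNorm_linkPush_zero]
      have h := sum_prefixLaw p r θ (j + 1) 0
      have h' := sum_prefixLaw p r' θ' (j + 1) 0
      simp only [Fintype.sum_unique] at h h'
      simp only [prefixNorm, Fintype.sum_unique, Pi.sub_apply, h, h', sub_self, abs_zero]
      positivity
    | succ i ihi =>
      refine (prefixNorm_linkPush_succ_le hp hp2 _ hcons i).trans ?_
      have h2p : 0 ≤ 1 - 2 * p := by linarith
      have h2p' : 0 ≤ 2 * p := by linarith
      calc _ ≤ (1 - 2 * p) * (2 * (1 / (1 + p)) ^ j * (1 + (1 - 2 * p) * p) ^ i) +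
            2 * p * (2 * (1 / (1 + p)) ^ (j + 1) * (1 + (1 - 2 * p) * p) ^ i) := by
            gcongr
            exact ih i
        _ = _ := by
            rw [pow_succ _ j, pow_succ _ i]
            field_simp
            ring

/-- The state after `j` noisy steps. -/
def chainState {α β : Type*} (step : ℕ → α → β → α) (a : α) : (j : ℕ) → (Fin j → β) → α
  | 0, _ => a
  | j + 1, c => step j (chainState step a j (Fin.init c)) (c (Fin.last j))

theorem sum_chainState (p : ℝ) (r : ℕ → (k : ℕ) → (Fin k → Bool) → Bool) (θ : Bool) (n j : ℕ)
    (f : (Fin n → Bool) → ℝ) :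
    ∑ c : Fin j → Fin n → Bool, (∏ l, ∏ i, flipWeight p (c l i)) *
      f (chainState (fun l (y e : Fin n → Bool) i =>
        xor (r l i fun t => y ⟨t, t.2.trans i.2⟩) (e i)) (fun _ => θ) j c) =
      ∑ y, prefixLaw p r θ j n y * f y := by
  induction j generalizing f with
  | zero => simp [chainState, prefixLaw]
  | succ j ih =>
    rw [sum_fin_succ_fun]
    simp only [Fin.prod_univ_castSucc, Fin.snoc_castSucc, Fin.snoc_last, chainState, Fin.init_snoc]
    have hstep : ∀ y : Fin n → Bool, ∑ e : Fin n → Bool, (∏ i, flipWeight p (e i)) *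
        f (fun i => xor (r j i fun t => y ⟨t, t.2.trans i.2⟩) (e i)) =
        ∑ y', linkKernel p (r j) n y y' * f y' := by
      intro y
      have hinv : Function.Involutive fun (e : Fin n → Bool) (i : Fin n) =>
          xor (r j i fun t => y ⟨t, t.2.trans i.2⟩) (e i) := fun e => by
        funext i
        simp
      rw [← Equiv.sum_comp hinv.toPerm]
      refine Finset.sum_congr rfl fun e _ => ?_
      simp only [Function.Involutive.coe_toPerm, linkKernel]
      congr 2
      exact hinv e
    have := ih fun y => ∑ y', linkKernel p (r j) n y y' * f y'
    simp only [← hstep] at this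
    simp only [prefixLaw, linkPush, Finset.sum_mul]
    rw [Finset.sum_comm (f := fun y' y => prefixLaw p r θ j n y * linkKernel p (r j) n y y' * f y')]
    simp only [mul_assoc, ← Finset.mul_sum, ← hstep]
    exact this

namespace RelayProtocol

variable {m n : ℕ}

/-- The bits sent by all the nodes, as functions of those received, given the message. -/
def strategy (P : RelayProtocol m n) (θ : Bool) : ℕ → (k : ℕ) → (Fin k → Bool) → Bool
  | 0, k, _ => if h : k < n then P.encode ⟨k, h⟩ θ else false
  | j + 1, k, y => if h : j + 1 < m ∧ k < n then P.relay ⟨j + 1, h.1⟩ ⟨k, h.2⟩ y else false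

theorem received_eq_chainState (P : RelayProtocol m n) (θ : Bool) (z : Fin n → Fin m → Bool)
    (j : ℕ) (hj : j ≤ m) : P.received θ z j hj =
      chainState (fun l (y e : Fin n → Bool) i =>
        xor (P.strategy θ l i fun t => y ⟨t, t.2.trans i.2⟩) (e i)) (fun _ => θ) j
        (fun l i => z i ⟨l, l.2.trans_le hj⟩) := by
  induction j with
  | zero => funext i; rfl
  | succ j ih =>
    funext i
    have ih' := ih (Nat.le_of_succ_le hj)
    cases j with
    | zero => simp [received, chainState, strategy]
    | succ j =>
      rw [received, ih']
      rw [chainState.eq_2 _ _ (j + 1)]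
      congr 1
      have : j + 1 < m := hj
      simp only [strategy, this, i.2, and_self, dif_pos]
      rfl

theorem errorProb_eq (P : RelayProtocol m n) (p : ℝ) :
    P.errorProb p = ∑ θ : Bool, 1 / 2 * ∑ y, prefixLaw p (P.strategy θ) θ m n y *
      (if P.decode y ≠ θ then 1 else 0) := by
  refine Finset.sum_congr rfl fun θ _ => ?_
  rw [← sum_chainState p (P.strategy θ) θ n m fun y => if P.decode y ≠ θ then 1 else 0,
    Finset.mul_sum, ← Equiv.sum_comp (Equiv.piComm fun (_ : Fin m) (_ : Fin n) => Bool)]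
  refine Finset.sum_congr rfl fun c _ => ?_
  rw [mul_assoc, estimate, received_eq_chainState, Finset.prod_comm]
  rfl

theorem half_sub_le_errorProb (P : RelayProtocol m n) (p : ℝ) :
    1 / 2 - 1 / 2 * prefixNorm (prefixLaw p (P.strategy true) true m -
      prefixLaw p (P.strategy false) false m) n ≤ P.errorProb p := by
  have h1 := sum_prefixLaw p (P.strategy true) true m n
  have h2 : ∑ y, (prefixLaw p (P.strategy true) true m n y - prefixLaw p (P.strategy true) true m n y *
      (if P.decode y ≠ true then 1 else 0) - prefixLaw p (P.strategy false) false m n y *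
      (if P.decode y ≠ false then 1 else 0)) ≤ prefixNorm (prefixLaw p (P.strategy true) true m -
      prefixLaw p (P.strategy false) false m) n := by
    refine Finset.sum_le_sum fun y _ => ?_
    simp only [Pi.sub_apply]
    cases P.decode y
    · simp
    · simpa using sub_le_iff_le_add.1 (le_abs_self _)
  rw [Finset.sum_sub_distrib, Finset.sum_sub_distrib, h1] at h2
  rw [errorProb_eq, Fintype.sum_bool]
  linarith

theorem one_third_le_of_errorProb_le (P : RelayProtocol (m + 1) n) {p : ℝ} (hp : 0 ≤ p)
    (hp2 : p ≤ 1 / 2) (h : P.errorProb p ≤ 1 / 3) :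
    1 / 3 ≤ 2 * (1 / (1 + p)) ^ m * (1 + (1 - 2 * p) * p) ^ n := by
  have h1 := P.half_sub_le_errorProb p
  have h2 := prefixNorm_sub_prefixLaw_le hp hp2 (P.strategy true) (P.strategy false)
    (fun j => rfl) true false m n
  linarith

end RelayProtocol

theorem exists_protocol_length_le {p : ℝ} (hp : 0 < p) (hp18 : p < 1 / 18) :
    ∀ᶠ m : ℕ in Filter.atTop, ∃ n : ℕ, (∃ P : RelayProtocol m n, P.errorProb p ≤ 1 / 3) ∧
      (n : ℝ) ≤ m * (1 + 864 * p) := by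
  set R := ⌊1 / (18 * p)⌋₊ with hRdef
  have hx : 1 ≤ 1 / (18 * p) := by rw [le_div_iff₀ (by positivity)]; linarith
  have hR : 1 ≤ R := Nat.le_floor (by exact_mod_cast hx)
  have hR1 : (1 : ℝ) ≤ R := by exact_mod_cast hR
  have hRp : R * p ≤ 1 / 18 := by
    have := Nat.floor_le (zero_le_one.trans hx)
    rw [le_div_iff₀ (by positivity)] at this
    linarith
  have hRp' : 1 ≤ 36 * p * R := by
    have := Nat.lt_floor_add_one (1 / (18 * p))
    rw [div_lt_iff₀ (by positivity), ← hRdef] at this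
    nlinarith
  filter_upwards [Filter.eventually_gt_atTop R] with m hm
  have hex : ∃ K, m ≤ R * 6 ^ K :=
    ⟨m, (Nat.lt_pow_self (by norm_num)).le.trans (Nat.le_mul_of_pos_left _ (by omega))⟩
  obtain ⟨K, hK, hKm⟩ : ∃ K, m ≤ R * 6 ^ (K + 1) ∧ R * 6 ^ K < m := by
    have hne : Nat.find hex ≠ 0 := fun h0 => by
      have := Nat.find_spec hex
      rw [h0, pow_zero] at this
      omega
    obtain ⟨K, hK⟩ := Nat.exists_eq_succ_of_ne_zero hne
    exact ⟨K, by have := Nat.find_spec hex; rwa [hK] at this,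
      not_le.1 (Nat.find_min hex (by omega))⟩
  obtain ⟨N, δ, hN, hδ, h⟩ := exists_reliable hp.le hR hRp (K + 1)
  obtain ⟨ℓ, rfl, hrel, hd⟩ := h m (by omega) hK
  refine ⟨_, ⟨majorityProtocol ℓ (K + 1 + 1),
    (errorProb_majorityProtocol_le hp.le (by linarith) hrel).trans (hN.trans (by norm_num))⟩, ?_⟩
  have h1 : chainDelay ℓ + 3 ^ (K + 1 + 1) ≤ ℓ.length + 1 + 24 * 6 ^ K := by
    rw [pow_succ 6] at hδ
    omega
  have h2 : ((chainDelay ℓ + 3 ^ (K + 1 + 1) : ℕ) : ℝ) ≤ (ℓ.length + 1 : ℕ) + 24 * 6 ^ K := by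
    exact_mod_cast h1
  have h3 : (R : ℝ) * 6 ^ K ≤ (ℓ.length + 1 : ℕ) := by exact_mod_cast hKm.le
  have h4 : (6 : ℝ) ^ K ≤ 36 * p * (ℓ.length + 1 : ℕ) := by
    calc (6 : ℝ) ^ K ≤ 36 * p * R * 6 ^ K := le_mul_of_one_le_left (by positivity) hRp'
      _ = 36 * p * (R * 6 ^ K) := by ring
      _ ≤ _ := by gcongr
  linarith

theorem le_lowerVelocity {p : ℝ} (hp : 0 < p) (hp18 : p < 1 / 18) :
    ENNReal.ofReal (1 - 864 * p) ≤ lowerVelocity p := by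
  refine Filter.le_liminf_of_le (by isBoundedDefault) ?_
  filter_upwards [exists_protocol_length_le hp hp18, Filter.eventually_gt_atTop 0]
    with m ⟨n, hP, hn⟩ hm
  have hle : (minBlockLength m p : ℝ≥0∞) ≤ n := by
    have : minBlockLength m p ≤ n := iInf₂_le n hP
    exact_mod_cast ENat.toENNReal_le.2 this
  refine le_trans ?_ (ENNReal.div_le_div_left hle _)
  rw [ENNReal.le_div_iff_mul_le (Or.inr (by simp; omega)) (Or.inl (by simp)),
    ← ENNReal.ofReal_natCast n, ← ENNReal.ofReal_natCast m,
    ← ENNReal.ofReal_mul' (Nat.cast_nonneg n)]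
  refine ENNReal.ofReal_le_ofReal ?_
  rcases le_total (1 - 864 * p) 0 with h0 | h0
  · exact (mul_nonpos_of_nonpos_of_nonneg h0 (Nat.cast_nonneg n)).trans (Nat.cast_nonneg m)
  · calc (1 - 864 * p) * n ≤ (1 - 864 * p) * (m * (1 + 864 * p)) := by gcongr
      _ = m * (1 - (864 * p) ^ 2) := by ring
      _ ≤ m := mul_le_of_le_one_right (Nat.cast_nonneg m) (by nlinarith [sq_nonneg (864 * p)])

theorem eventually_le_length {p : ℝ} (hp : 0 < p) (hp2 : p < 1 / 2) :
    ∀ᶠ m : ℕ in Filter.atTop, ∀ n : ℕ,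
      1 / 3 ≤ 2 * (1 / (1 + p)) ^ m * (1 + (1 - 2 * p) * p) ^ n →
        ((m + 1 : ℕ) : ℝ) ≤ (1 - p) * n := by
  set κ := p / (1 + p) - (1 - 2 * p) * p / (1 - p) with hκdef
  set C := 2 * Real.exp ((1 - 2 * p) * p / (1 - p)) with hC
  have hp1 : 0 < 1 - p := by linarith
  have hκ : 0 < κ := by
    rw [hκdef, sub_pos, div_lt_div_iff₀ hp1 (by linarith)]
    nlinarith [mul_pos hp (mul_pos hp hp)]
  have hlim : Filter.Tendsto (fun m : ℕ => C * Real.exp (-κ) ^ m) Filter.atTop (nhds (C * 0)) :=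
    (tendsto_pow_atTop_nhds_zero_of_lt_one (Real.exp_pos _).le
      (Real.exp_zero ▸ Real.exp_lt_exp.2 (by linarith))).const_mul C
  rw [mul_zero] at hlim
  filter_upwards [hlim.eventually_lt_const (by norm_num : (0 : ℝ) < 1 / 3)] with m hm n hmn
  by_contra! hlt
  refine absurd (hmn.trans_lt (lt_of_le_of_lt ?_ hm)) (lt_irrefl _)
  have hη : 0 ≤ (1 - 2 * p) * p := by nlinarith
  have h1 : (1 / (1 + p)) ^ m ≤ Real.exp (-(p / (1 + p))) ^ m := by
    gcongr
    have := Real.add_one_le_exp (-(p / (1 + p)))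
    refine le_trans (le_of_eq ?_) this
    field_simp
    ring
  have h2 : (1 + (1 - 2 * p) * p) ^ n ≤
      Real.exp ((1 - 2 * p) * p / (1 - p)) ^ (m + 1) := by
    calc (1 + (1 - 2 * p) * p) ^ n ≤ Real.exp ((1 - 2 * p) * p) ^ n := by
          gcongr
          linarith [Real.add_one_le_exp ((1 - 2 * p) * p)]
      _ ≤ _ := by
          rw [← Real.exp_nat_mul, ← Real.exp_nat_mul]
          refine Real.exp_le_exp.2 ?_
          rw [← mul_div_assoc, le_div_iff₀ hp1]
          calc _ = (1 - p) * n * ((1 - 2 * p) * p) := by ring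
            _ ≤ _ := by gcongr
  calc _ ≤ 2 * Real.exp (-(p / (1 + p))) ^ m *
        Real.exp ((1 - 2 * p) * p / (1 - p)) ^ (m + 1) := by gcongr
    _ = C * (Real.exp (-(p / (1 + p))) * Real.exp ((1 - 2 * p) * p / (1 - p))) ^ m := by
        rw [hC, mul_pow, pow_succ]; ring
    _ = C * Real.exp (-κ) ^ m := by
        rw [← Real.exp_add, hκdef]; congr 3; ring

theorem minBlockLength_eq_top_or (m : ℕ) (p : ℝ) : minBlockLength m p = ⊤ ∨
    ∃ n : ℕ, (∃ P : RelayProtocol m n, P.errorProb p ≤ 1 / 3) ∧ minBlockLength m p = n := by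
  classical
  by_cases h : ∃ n : ℕ, ∃ P : RelayProtocol m n, P.errorProb p ≤ 1 / 3
  · exact Or.inr ⟨Nat.find h, Nat.find_spec h, le_antisymm (iInf₂_le (Nat.find h) (Nat.find_spec h))
      (le_iInf₂ fun k hk => Nat.cast_le.2 (Nat.find_min' h hk))⟩
  · exact Or.inl (by simpa [minBlockLength] using h)

theorem upperVelocity_le {p : ℝ} (hp : 0 < p) (hp2 : p < 1 / 2) :
    upperVelocity p ≤ ENNReal.ofReal (1 - p) := by
  rw [upperVelocity, ← Filter.limsup_nat_add _ 1]
  refine Filter.limsup_le_of_le (by isBoundedDefault) ?_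
  filter_upwards [eventually_le_length hp hp2] with m hm
  rcases minBlockLength_eq_top_or (m + 1) p with h | ⟨n, ⟨P, hP⟩, h⟩
  · simp [h]
  · rw [h]
    have hn := hm n (P.one_third_le_of_errorProb_le hp.le hp2.le hP)
    refine ENNReal.div_le_of_le_mul ?_
    rw [ENat.toENNReal_coe, ← ENNReal.ofReal_natCast n, ← ENNReal.ofReal_natCast (m + 1),
      ← ENNReal.ofReal_mul' (Nat.cast_nonneg n)]
    exact ENNReal.ofReal_le_ofReal hn

theorem theorem2 :
    ∃ a b p₀ : ℝ, 0 < a ∧ 0 < b ∧ 0 < p₀ ∧ p₀ ≤ 1 / 2 ∧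
      ∀ p : ℝ, 0 < p → p < p₀ →
        ENNReal.ofReal (1 - b * p) ≤ lowerVelocity p ∧
        lowerVelocity p ≤ upperVelocity p ∧
        upperVelocity p ≤ ENNReal.ofReal (1 - a * p) := by
  refine ⟨1, 864, 1 / 18, by norm_num, by norm_num, by norm_num, by norm_num,
    fun p hp hp18 => ⟨le_lowerVelocity hp hp18, Filter.liminf_le_limsup, ?_⟩⟩
  rw [one_mul]
  exact upperVelocity_le hp (by linarith)
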